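/- Let $\sigma\in\mathbb{R}$, $q_0>0$, and let $\mathbf{q}_\pm\in\mathbb{C}^2$ satisfy $\|\mathbf{q}_\pm\|=q_0$ and be non-parallel, i.e. $|\mathbf{q}_+^\dagger\mathbf{q}_-|<q_0^2$ (the orthogonal case $\mathbf{q}_+^\dagger\mathbf{q}_-=0$ is included). Let $\mathbf{q}(x,t)\in\mathbb{C}^2$, $(x,t)\in\mathbb{R}^2$, be a classical solution of the defocusing-defocusing coupled Hirota equations $$\mathrm{i}\mathbf{q}_t+\mathbf{q}_{xx}-2(\|\mathbf{q}\|^2-q_0^2)\mathbf{q}+\mathrm{i}\sigma\left[\mathbf{q}_{xxx}-3\|\mathbf{q}\|^2\mathbf{q}_x-3(\mathbf{q}^\dagger\mathbf{q}_x)\mathbf{q}\right]=\mathbf{0}$$ such that for every $t$: $\lim_{x\to\pm\infty}\mathbf{q}(x,t)=\mathbf{q}_\pm$, $\mathbf{q}(\cdot,t)-\mathbf{q}_-\in L^1(-\infty,0)$ and $\mathbf{q}(\cdot,t)-\mathbf{q}_+\in L^1(0,\infty)$. For real $z\notin\{0,\pm q_0\}$ put $k=\frac12(z+q_0^2/z)$,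 $\lambda=\frac12(z-q_0^2/z)$, $\widehat\rho=z^2/(z^2-q_0^2)$, $\mathbf{v}^\perp=(v_2,-v_1)^\dagger$, $$\mathbf{J}=\operatorname{diag}(1,-1,-1),\quad \mathbf{Q}=\begin{pmatrix}0&-\mathbf{q}^\dagger\\ \mathbf{q}&\mathbf{0}\end{pmatrix},\quad \widehat{\mathbf{Y}}_\pm=\begin{pmatrix}\mathrm{i}\widehat\rho&0&\widehat\rho q_0/z\\ \mathrm{i}\widehat\rho\,\mathbf{q}_\pm/z&\mathbf{q}_\pm^\perp/q_0&\widehat\rho\,\mathbf{q}_\pm/q_0\end{pmatrix},$$ $\mathbf{\Delta}=\operatorname{diag}(\delta_1,\delta_2,-\delta_1)$, $\delta_1=\lambda x+2\lambda[k+\sigma(3k^2-\lambda^2)]t$, $\delta_2=-kx-(\lambda^2+k^2+4\sigma k^3)t$. The Jost solutions $\psi_\pm(z;x,t)$ are the $3\times3$ matrix solutions of $\psi_x=(\mathrm{i}k\mathbf{J}+\mathrm{i}\mathbf{Q})\psi$ with $\psi_\pm=\widehat{\mathbf{Y}}_\pm\mathrm{e}^{\mathrm{i}\mathbf{\Delta}}+o(1)$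 as $x\to\pm\infty$; the scattering matrix $\mathbf{H}=(h_{ij})$ is defined by $\psi_+=\psi_-\mathbf{H}$, $\mathbf{S}=\mathbf{H}^{-1}=(s_{ij})$, and the reflection coefficients are $\beta_1=s_{13}/s_{11}$ and $\beta_2=h_{21}/h_{11}$. Then, at every time $t$, the scattering matrix $\mathbf{H}(z)$ exists and is unique for all $z\in\mathbb{R}\setminus\{0,\pm q_0\}$, and $\mathbf{q}$ is not reflectionless: it is impossible that for all $z\in\mathbb{R}\setminus\{0,\pm q_0\}$ both reflection coefficients are defined ($s_{11}(z)\ne0$, $h_{11}(z)\ne0$) and $\beta_1(z)=\beta_2(z)=0$. In other words, there are no pure soliton solutions with non-parallel boundary values. -/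

import Mathlib

open Complex Filter Topology MeasureTheory

noncomputable section

namespace CoupledHirota

/-- `q` is a classical solution on `ℝ × ℝ` of the defocusing-defocusing coupled Hirota equations
`i q_t + q_xx - 2 (‖q‖² - q₀²) q + i σ (q_xxx - 3 ‖q‖² q_x - 3 (q† q_x) q) = 0`;
the first argument of `q` is `x`, the second is `t`, and `inner ℂ u v = u† v`. -/
structure IsSolution (σ q₀ : ℝ) (q : ℝ → ℝ → EuclideanSpace ℂ (Fin 2)) : Prop where
  contDiff_x : ∀ t, ContDiff ℝ 3 (fun x => q x t)
  differentiable_t : ∀ x, Differentiable ℝ (fun t => q x t)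
  equation : ∀ x t,
    I • deriv (fun s => q x s) t + iteratedDeriv 2 (fun y => q y t) x
      - ((2 * (‖q x t‖ ^ 2 - q₀ ^ 2) : ℝ) : ℂ) • q x t
      + (I * (σ : ℂ)) • (iteratedDeriv 3 (fun y => q y t) x
          - ((3 * ‖q x t‖ ^ 2 : ℝ) : ℂ) • deriv (fun y => q y t) x
          - (3 * inner ℂ (q x t) (deriv (fun y => q y t) x)) • q x t) = 0

/-- `k(z) = (z + q₀² / z) / 2`. -/
def k (q₀ z : ℝ) : ℝ := (z + q₀ ^ 2 / z) / 2

/-- `λ(z) = (z - q₀² / z) / 2`. -/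
def lam (q₀ z : ℝ) : ℝ := (z - q₀ ^ 2 / z) / 2

/-- `ρ̂(z) = z² / (z² - q₀²)`. -/
def rho (q₀ z : ℝ) : ℝ := z ^ 2 / (z ^ 2 - q₀ ^ 2)

/-- The matrix `J = diag(1, -1, -1)`. -/
def J : Matrix (Fin 3) (Fin 3) ℂ := Matrix.diagonal ![1, -1, -1]

/-- The matrix `Q` with blocks `0`, `-v†`, `v`, `0`. -/
def Q (v : EuclideanSpace ℂ (Fin 2)) : Matrix (Fin 3) (Fin 3) ℂ :=
  !![0, -star (v 0), -star (v 1);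
     v 0, 0, 0;
     v 1, 0, 0]

/-- The matrix `X = i k J + i Q` of the scattering problem `ψ_x = X ψ`. -/
def X (q₀ z : ℝ) (v : EuclideanSpace ℂ (Fin 2)) : Matrix (Fin 3) (Fin 3) ℂ :=
  (I * (k q₀ z : ℂ)) • J + I • Q v

/-- The orthogonal vector `v^⊥ = (v₂, -v₁)†`. -/
def perp (v : EuclideanSpace ℂ (Fin 2)) : EuclideanSpace ℂ (Fin 2) :=
  !₂[star (v 1), -star (v 0)]

/-- The eigenvector matrix `Ŷ(z)` of the limit problem with boundary value `v`; its columns are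
`ρ̂ (i, i v / z)`, `(0, v^⊥ / q₀)` and `ρ̂ (q₀ / z, v / q₀)`. -/
def Y (q₀ z : ℝ) (v : EuclideanSpace ℂ (Fin 2)) : Matrix (Fin 3) (Fin 3) ℂ :=
  !![rho q₀ z * I, 0, rho q₀ z * (q₀ / z);
     rho q₀ z * (I * v 0 / z), perp v 0 / q₀, rho q₀ z * (v 0 / q₀);
     rho q₀ z * (I * v 1 / z), perp v 1 / q₀, rho q₀ z * (v 1 / q₀)]

/-- The phase `δ₁ = λ x + 2 λ (k + σ (3 k² - λ²)) t`. -/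
def delta₁ (σ q₀ z x t : ℝ) : ℝ :=
  lam q₀ z * x + 2 * lam q₀ z * (k q₀ z + σ * (3 * k q₀ z ^ 2 - lam q₀ z ^ 2)) * t

/-- The phase `δ₂ = -k x - (λ² + k² + 4 σ k³) t`. -/
def delta₂ (σ q₀ z x t : ℝ) : ℝ :=
  -(k q₀ z * x) - (lam q₀ z ^ 2 + k q₀ z ^ 2 + 4 * σ * k q₀ z ^ 3) * t

/-- The matrix `e^{iΔ}` with `Δ = diag(δ₁, δ₂, -δ₁)`. -/
def expIDelta (σ q₀ z x t : ℝ) : Matrix (Fin 3) (Fin 3) ℂ :=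
  Matrix.diagonal ![exp (I * (delta₁ σ q₀ z x t : ℂ)), exp (I * (delta₂ σ q₀ z x t : ℂ)),
    exp (-(I * (delta₁ σ q₀ z x t : ℂ)))]

/-- `ψ` is, at time `t` and spectral parameter `z`, a Jost solution for the boundary value `v`:
it solves `ψ_x = X ψ` on the line and `ψ = Ŷ e^{iΔ} + o(1)` along `l`, where `l` is `atBot`
(for `ψ₋`, with `v = q₋`) or `atTop` (for `ψ₊`, with `v = q₊`). The derivative is taken
entry by entry. -/
structure IsJost (σ q₀ : ℝ) (q : ℝ → ℝ → EuclideanSpace ℂ (Fin 2)) (t z : ℝ)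
    (l : Filter ℝ) (v : EuclideanSpace ℂ (Fin 2)) (ψ : ℝ → Matrix (Fin 3) (Fin 3) ℂ) : Prop where
  hasDerivAt : ∀ x i j, HasDerivAt (fun y => ψ y i j) ((X q₀ z (q x t) * ψ x) i j) x
  tendsto : Tendsto (fun x => ψ x - Y q₀ z v * expIDelta σ q₀ z x t) l (𝓝 0)

/-- `H` is the scattering matrix at time `t` and spectral parameter `z`: `ψ₊ = ψ₋ H`. -/
def IsScatteringMatrix (σ q₀ : ℝ) (qm qp : EuclideanSpace ℂ (Fin 2))
    (q : ℝ → ℝ → EuclideanSpace ℂ (Fin 2)) (t z : ℝ) (H : Matrix (Fin 3) (Fin 3) ℂ) : Prop :=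
  ∃ ψm ψp : ℝ → Matrix (Fin 3) (Fin 3) ℂ,
    IsJost σ q₀ q t z atBot qm ψm ∧ IsJost σ q₀ q t z atTop qp ψp ∧ ∀ x, ψp x = ψm x * H

/-- The reflection coefficient `β₁ = s₁₃ / s₁₁`, where `S = H⁻¹`. -/
def beta₁ (H : Matrix (Fin 3) (Fin 3) ℂ) : ℂ := H⁻¹ 0 2 / H⁻¹ 0 0

/-- The reflection coefficient `β₂ = h₂₁ / h₁₁`. -/
def beta₂ (H : Matrix (Fin 3) (Fin 3) ℂ) : ℂ := H 1 0 / H 0 0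

/-- The reflection coefficients of the scattering matrix `H` are defined and both vanish. At a
zero of `h₁₁` at least one of them is infinite, since the first column of `H` is not zero, so
such a point does not count as a point of vanishing reflection. -/
structure ReflectionVanishes (H : Matrix (Fin 3) (Fin 3) ℂ) : Prop where
  s₁₁_ne_zero : H⁻¹ 0 0 ≠ 0
  h₁₁_ne_zero : H 0 0 ≠ 0
  beta₁_eq_zero : beta₁ H = 0
  beta₂_eq_zero : beta₂ H = 0

end CoupledHirota

end

/-! The equation `ψ_x = X ψ` preserves the indefinite form `u† J u`, because `X† J + J X = 0`. The
columns of `Y e^{iΔ}` are orthogonal for this form and none of them is isotropic; hence the Jost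
solutions are unique and `H` is unitary for a diagonal form. If both reflection coefficients
vanish, the first column of `H` is then `(h, 0, 0)` with `‖h‖ = 1`: the first columns of `ψ₊` and
`ψ₋` differ by a unimodular factor.

Now let `z → 0⁺`. Normalized to remain bounded, the first Jost column `(f, u)` satisfies
`(e^{-iλx} u)' = i e^{-iλx} (f q - z u)`. Here `f` rotates in the gauge `e^{-iλx}` at the frequency
`k - λ = q₀² / z → ∞`, so that the derivative of `u` averages out and `e^{-iλx} u` is constant in
the limit. It tends to multiples of `q₋` and `q₊` by unimodular factors as `x → ∓∞`, uniformly in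
`z`, hence in the absence of reflection `q₊ = h q₋` with `‖h‖ = 1` in the limit, and `q₋`, `q₊` are
parallel. -/

noncomputable section

namespace CoupledHirota

section LinearEquation

variable {E : Type*} [NormedAddCommGroup E] [NormedSpace ℝ E]

lemma hasDerivAt_integral_Ioi [CompleteSpace E] {f : ℝ → E} (hf : Continuous f)
    (hint : ∀ x, IntegrableOn f (Set.Ioi x)) (x : ℝ) :
    HasDerivAt (fun y => ∫ s in Set.Ioi y, f s) (-f x) x := by
  have hsplit : (fun y => ∫ s in Set.Ioi y, f s) =
      fun y => (∫ s in Set.Ioi x, f s) - ∫ s in x..y, f s := by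
    funext y
    rw [← intervalIntegral.integral_Ioi_sub_Ioi' (hint x) (hint y), sub_sub_cancel]
  rw [hsplit]
  exact (intervalIntegral.integral_hasDerivAt_right (hf.intervalIntegrable x x)
    (hf.stronglyMeasurableAtFilter _ _) hf.continuousAt).const_sub _

/-- The pairs consisting of an end of the real line, as a filter, and of the half-lines which
reach out to it, as a function of their end point. It lets both ends be treated at once. -/
inductive IsEnd : Filter ℝ → (ℝ → Set ℝ) → Prop
  | top : IsEnd atTop Set.Ioi
  | bot : IsEnd atBot Set.Iic

variable {l : Filter ℝ} {S : ℝ → Set ℝ}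

lemma IsEnd.neBot (hl : IsEnd l S) : l.NeBot := by
  cases hl <;> infer_instance

lemma IsEnd.tendsto_integral (hl : IsEnd l S) (f : ℝ → E) :
    Tendsto (fun x => ∫ s in S x, f s) l (𝓝 0) := by
  cases hl with
  | top => exact tendsto_integral_Ioi_zero tendsto_id
  | bot => exact tendsto_integral_Iic_zero tendsto_id

lemma IsEnd.integrableOn {F : Type*} [NormedAddCommGroup F] (hl : IsEnd l S) {f : ℝ → F}
    (hf : Continuous f) (hint : IntegrableAtFilter f l) (x : ℝ) : IntegrableOn f (S x) := by
  have hloc (s : Set ℝ) : LocallyIntegrableOn f s := hf.locallyIntegrable.locallyIntegrableOn s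
  cases hl with
  | top =>
    exact (integrableOn_Ici_iff_integrableAtFilter_atTop.2 ⟨hint, hloc _⟩).mono_set
      Set.Ioi_subset_Ici_self
  | bot => exact integrableOn_Iic_iff_integrableAtFilter_atBot.2 ⟨hint, hloc _⟩

section IteratedIntegral

variable {f : ℝ → ℝ}

lemma hasDerivAt_integral_Ioi_pow (hf : Continuous f) (hint : ∀ x, IntegrableOn f (Set.Ioi x))
    (m : ℕ) (x : ℝ) :
    HasDerivAt (fun y => (∫ s in Set.Ioi y, f s) ^ (m + 1) / (m + 1).factorial)
      (-(f x * ((∫ s in Set.Ioi x, f s) ^ m / m.factorial))) x := by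
  have hfact : (m.factorial : ℝ) ≠ 0 := by positivity
  refine (((hasDerivAt_integral_Ioi hf hint x).pow (m + 1)).div_const
    ((m + 1).factorial : ℝ)).congr_deriv ?_
  rw [Nat.factorial_succ, Nat.add_sub_cancel]
  push_cast
  field_simp

lemma tendsto_integral_Ioi_pow (f : ℝ → ℝ) (m : ℕ) :
    Tendsto (fun y => (∫ s in Set.Ioi y, f s) ^ (m + 1) / (m + 1).factorial) atTop (𝓝 0) := by
  simpa using ((IsEnd.top.tendsto_integral f).pow (m + 1)).div_const ((m + 1).factorial : ℝ)

lemma mul_integral_Ioi_pow_nonneg (hf0 : ∀ x, 0 ≤ f x) (m : ℕ) (x : ℝ) :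
    0 ≤ f x * ((∫ s in Set.Ioi x, f s) ^ m / m.factorial) :=
  mul_nonneg (hf0 x) (div_nonneg (pow_nonneg (integral_nonneg hf0) m) (by positivity))

lemma integrableOn_mul_integral_Ioi_pow (hf : Continuous f)
    (hint : ∀ x, IntegrableOn f (Set.Ioi x)) (hf0 : ∀ x, 0 ≤ f x) (m : ℕ) (x : ℝ) :
    IntegrableOn (fun s => f s * ((∫ r in Set.Ioi s, f r) ^ m / m.factorial)) (Set.Ioi x) := by
  exact integrable_neg_iff.1 (integrableOn_Ioi_deriv_of_nonpos' (a := x)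
    (fun y _ => hasDerivAt_integral_Ioi_pow hf hint m y)
    (fun y _ => neg_nonpos.2 (mul_integral_Ioi_pow_nonneg hf0 m y)) (tendsto_integral_Ioi_pow f m))

lemma integral_mul_integral_Ioi_pow (hf : Continuous f)
    (hint : ∀ x, IntegrableOn f (Set.Ioi x)) (hf0 : ∀ x, 0 ≤ f x) (m : ℕ) (x : ℝ) :
    ∫ s in Set.Ioi x, f s * ((∫ r in Set.Ioi s, f r) ^ m / m.factorial) =
      (∫ s in Set.Ioi x, f s) ^ (m + 1) / (m + 1).factorial := by
  have h := integral_Ioi_of_hasDerivAt_of_nonpos' (a := x)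
    (fun y _ => hasDerivAt_integral_Ioi_pow hf hint m y)
    (fun y _ => neg_nonpos.2 (mul_integral_Ioi_pow_nonneg hf0 m y)) (tendsto_integral_Ioi_pow f m)
  rw [integral_neg] at h
  linarith

end IteratedIntegral

section Dyson

variable {A : Type*} [NormedRing A] {a : ℝ → A}

lemma norm_mul_le_of_norm_le_pow {c g : A} {m : ℕ} {x : ℝ}
    (hg : ‖g‖ ≤ ‖c‖ * ((∫ s in Set.Ioi x, ‖a s‖) ^ m / m.factorial)) :
    ‖a x * g‖ ≤ ‖c‖ * (‖a x‖ * ((∫ s in Set.Ioi x, ‖a s‖) ^ m / m.factorial)) :=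
  calc ‖a x * g‖ ≤ ‖a x‖ * ‖g‖ := norm_mul_le _ _
    _ ≤ ‖a x‖ * (‖c‖ * ((∫ s in Set.Ioi x, ‖a s‖) ^ m / m.factorial)) := by gcongr
    _ = _ := mul_left_comm _ _ _

lemma integrableOn_mul_of_norm_le_pow (ha : Continuous a)
    (hint : ∀ x, IntegrableOn a (Set.Ioi x)) {c : A} {m : ℕ} {g : ℝ → A} (hg : Continuous g)
    (hgle : ∀ x, ‖g x‖ ≤ ‖c‖ * ((∫ s in Set.Ioi x, ‖a s‖) ^ m / m.factorial)) (x : ℝ) :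
    IntegrableOn (fun s => a s * g s) (Set.Ioi x) :=
  Integrable.mono' ((integrableOn_mul_integral_Ioi_pow ha.norm (fun y => (hint y).norm)
      (fun _ => norm_nonneg _) m x).const_mul ‖c‖) (ha.mul hg).aestronglyMeasurable
    (ae_of_all _ fun s => norm_mul_le_of_norm_le_pow (hgle s))

variable [NormedAlgebra ℝ A]

/-- The terms of the Dyson series of the solution of `g' = a g` which tends to `c` at `+∞`. -/
def dyson (a : ℝ → A) (c : A) : ℕ → ℝ → A
  | 0, _ => c
  | m + 1, x => -∫ s in Set.Ioi x, a s * dyson a c m s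

variable [CompleteSpace A]

lemma continuous_dyson_and_norm_dyson_le (ha : Continuous a)
    (hint : ∀ x, IntegrableOn a (Set.Ioi x)) (c : A) (m : ℕ) :
    Continuous (dyson a c m) ∧
      ∀ x, ‖dyson a c m x‖ ≤ ‖c‖ * ((∫ s in Set.Ioi x, ‖a s‖) ^ m / m.factorial) := by
  induction m with
  | zero => exact ⟨continuous_const, fun x => by simp [dyson]⟩
  | succ m ih =>
    obtain ⟨hcont, hle⟩ := ih
    have hi := integrableOn_mul_of_norm_le_pow ha hint hcont hle
    refine ⟨continuous_iff_continuousAt.2 fun x =>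
      (hasDerivAt_integral_Ioi (ha.mul hcont) hi x).neg.continuousAt, fun x => ?_⟩
    calc ‖dyson a c (m + 1) x‖ = ‖∫ s in Set.Ioi x, a s * dyson a c m s‖ := norm_neg _
      _ ≤ ∫ s in Set.Ioi x,
            ‖c‖ * (‖a s‖ * ((∫ r in Set.Ioi s, ‖a r‖) ^ m / m.factorial)) :=
        norm_integral_le_of_norm_le ((integrableOn_mul_integral_Ioi_pow ha.norm
          (fun y => (hint y).norm) (fun _ => norm_nonneg _) m x).const_mul ‖c‖)
          (ae_of_all _ fun s => norm_mul_le_of_norm_le_pow (hle s))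
      _ = ‖c‖ * ((∫ s in Set.Ioi x, ‖a s‖) ^ (m + 1) / (m + 1).factorial) := by
        rw [integral_const_mul, integral_mul_integral_Ioi_pow ha.norm (fun y => (hint y).norm)
          (fun _ => norm_nonneg _)]

lemma norm_dyson_le (ha : Continuous a) (hint : ∀ x, IntegrableOn a (Set.Ioi x)) (c : A) (m : ℕ)
    (x : ℝ) : ‖dyson a c m x‖ ≤ ‖c‖ * ((∫ s in Set.Ioi x, ‖a s‖) ^ m / m.factorial) :=
  (continuous_dyson_and_norm_dyson_le ha hint c m).2 x

lemma hasDerivAt_dyson_succ (ha : Continuous a) (hint : ∀ x, IntegrableOn a (Set.Ioi x)) (c : A)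
    (m : ℕ) (x : ℝ) : HasDerivAt (dyson a c (m + 1)) (a x * dyson a c m x) x := by
  obtain ⟨hcont, hle⟩ := continuous_dyson_and_norm_dyson_le ha hint c m
  exact (hasDerivAt_integral_Ioi (ha.mul hcont)
    (integrableOn_mul_of_norm_le_pow ha hint hcont hle) x).neg.congr_deriv (neg_neg _)

lemma summable_dyson (ha : Continuous a) (hint : ∀ x, IntegrableOn a (Set.Ioi x)) (c : A)
    (x : ℝ) : Summable fun m => dyson a c m x :=
  .of_norm_bounded ((Real.summable_pow_div_factorial _).mul_left ‖c‖)
    fun m => norm_dyson_le ha hint c m x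

lemma hasDerivAt_tsum_dyson_succ (ha : Continuous a) (hint : ∀ x, IntegrableOn a (Set.Ioi x))
    (c : A) (x : ℝ) :
    HasDerivAt (fun y => ∑' m, dyson a c (m + 1) y) (a x * ∑' m, dyson a c m x) x := by
  obtain ⟨K, hK⟩ := isCompact_Icc.exists_bound_of_continuousOn
    (ha.continuousOn (s := Set.Icc (x - 1) (x + 1)))
  have hmem : x ∈ Set.Ioo (x - 1) (x + 1) := by constructor <;> linarith
  rw [← (summable_dyson ha hint c x).tsum_mul_left]
  refine hasDerivAt_tsum_of_isPreconnected (g := fun m => dyson a c (m + 1))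
    (g' := fun m y => a y * dyson a c m y)
    (u := fun m => K * (‖c‖ * ((∫ s in Set.Ioi (x - 1), ‖a s‖) ^ m / m.factorial)))
    (((Real.summable_pow_div_factorial _).mul_left _).mul_left _)
    isOpen_Ioo isPreconnected_Ioo (fun m y _ => hasDerivAt_dyson_succ ha hint c m y)
    (fun m y hy => ?_) hmem ((summable_nat_add_iff 1).2 (summable_dyson ha hint c x)) hmem
  have hKy := hK y (Set.Ioo_subset_Icc_self hy)
  have hK0 : 0 ≤ K := (norm_nonneg _).trans hKy
  have htail : ∫ s in Set.Ioi y, ‖a s‖ ≤ ∫ s in Set.Ioi (x - 1), ‖a s‖ :=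
    setIntegral_mono_set (hint _).norm (ae_of_all _ fun s => norm_nonneg _)
      (Set.Ioi_subset_Ioi hy.1.le).eventuallyLE
  calc ‖a y * dyson a c m y‖ ≤ ‖a y‖ * ‖dyson a c m y‖ := norm_mul_le _ _
    _ ≤ K * (‖c‖ * ((∫ s in Set.Ioi y, ‖a s‖) ^ m / m.factorial)) :=
      mul_le_mul hKy (norm_dyson_le ha hint c m y) (norm_nonneg _) hK0
    _ ≤ K * (‖c‖ * ((∫ s in Set.Ioi (x - 1), ‖a s‖) ^ m / m.factorial)) := by
      gcongr

lemma exists_hasDerivAt_mul_norm_sub_le_atTop (ha : Continuous a)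
    (hint : ∀ x, IntegrableOn a (Set.Ioi x)) (c : A) :
    ∃ g : ℝ → A, (∀ x, HasDerivAt g (a x * g x) x) ∧
      ∀ x, ‖g x - c‖ ≤ ‖c‖ * (Real.exp (∫ s in Set.Ioi x, ‖a s‖) - 1) := by
  have hg : ∀ x, ∑' m, dyson a c m x = c + ∑' m, dyson a c (m + 1) x := fun x =>
    (summable_dyson ha hint c x).tsum_eq_zero_add
  refine ⟨fun x => ∑' m, dyson a c m x, fun x => ?_, fun x => ?_⟩
  · simpa only [← hg] using (hasDerivAt_tsum_dyson_succ ha hint c x).const_add c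
  · change ‖∑' m, dyson a c m x - c‖ ≤ _
    have hexp := (NormedSpace.expSeries_div_hasSum_exp (∫ s in Set.Ioi x, ‖a s‖)).mul_left ‖c‖
    rw [← Real.exp_eq_exp_ℝ, ← hasSum_nat_add_iff' 1] at hexp
    rw [hg, add_sub_cancel_left]
    refine tsum_of_norm_bounded ?_ fun m => norm_dyson_le ha hint c (m + 1) x
    simpa [mul_sub] using hexp

lemma IsEnd.exists_hasDerivAt_mul_norm_sub_le (hl : IsEnd l S) (ha : Continuous a)
    (hint : ∀ x, IntegrableOn a (S x)) (c : A) :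
    ∃ g : ℝ → A, (∀ x, HasDerivAt g (a x * g x) x) ∧
      ∀ x, ‖g x - c‖ ≤ ‖c‖ * (Real.exp (∫ s in S x, ‖a s‖) - 1) := by
  cases hl with
  | top => exact exists_hasDerivAt_mul_norm_sub_le_atTop ha hint c
  | bot =>
    have hint' (x : ℝ) : IntegrableOn (fun s => -a (-s)) (Set.Ioi x) := by
      have h := ((Measure.measurePreserving_neg volume).integrableOn_comp_preimage
        (Homeomorph.neg ℝ).measurableEmbedding).2 (hint (-x))
      rw [Set.neg_preimage, Set.neg_Iic, neg_neg] at h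
      exact (h.mono_set Set.Ioi_subset_Ici_self).neg
    obtain ⟨g, hg, hle⟩ := exists_hasDerivAt_mul_norm_sub_le_atTop
      (a := fun s => -a (-s)) (ha.comp continuous_neg).neg hint' c
    refine ⟨fun x => g (-x), fun x => ?_, fun x => ?_⟩
    · exact ((hg (-x)).scomp x (hasDerivAt_neg x)).congr_deriv (by simp)
    · simpa only [norm_neg, integral_comp_neg_Ioi (-x) (fun s => ‖a s‖), neg_neg] using hle (-x)

end Dyson

end LinearEquation

section SlowComponents

variable {V : Type*} [NormedAddCommGroup V] [InnerProductSpace ℂ V] {q₀ z : ℝ} {q : ℝ → V}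
  {f : ℝ → ℂ} {u : ℝ → V}

/-- `(f, u)` is a vector solution of the scattering problem `ψ_x = X ψ`, split into its first
component and the others, with a potential `q` which may have any number of components. -/
structure IsVectorSolution (q₀ z : ℝ) (q : ℝ → V) (f : ℝ → ℂ) (u : ℝ → V) : Prop where
  hasDerivAt_fst : ∀ x, HasDerivAt f (I * k q₀ z * f x - I * inner ℂ (q x) (u x)) x
  hasDerivAt_snd : ∀ x, HasDerivAt u ((I * f x) • q x - (I * k q₀ z) • u x) x

lemma hasDerivAt_cexp_neg_lam (q₀ z x : ℝ) :
    HasDerivAt (fun x : ℝ => exp (I * ↑(-(lam q₀ z * x))))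
      (-(I * lam q₀ z) * exp (I * ↑(-(lam q₀ z * x)))) x := by
  have h : HasDerivAt (fun x => -(lam q₀ z * x)) (-lam q₀ z) x := by
    simpa using! ((hasDerivAt_id x).const_mul (lam q₀ z)).neg
  refine (h.ofReal_comp.const_mul I).cexp.congr_deriv ?_
  push_cast
  ring

-- In the gauge `e^{-iλx}` the vector `u` is driven by `f q`, and `f` rotates at the high frequency
-- `k - λ = q₀² / z`; the subtracted term is the corresponding oscillation of `u`.
lemma IsVectorSolution.hasDerivAt_slow (hu : IsVectorSolution q₀ z q f u) (hq₀ : q₀ ≠ 0)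
    (hz : z ≠ 0) {q' : V} {x : ℝ} (hq : HasDerivAt q q' x) :
    HasDerivAt
      (fun x => exp (I * ↑(-(lam q₀ z * x))) • (u x - (z / q₀ ^ 2 * f x) • q x))
      (exp (I * ↑(-(lam q₀ z * x))) • -((z : ℂ) • (I • u x +
        (1 / q₀ ^ 2 : ℂ) • (f x • q' - (I * inner ℂ (q x) (u x)) • q x)))) x := by
  have hz' : (z : ℂ) ≠ 0 := by exact_mod_cast hz
  have hq' : (q₀ : ℂ) ≠ 0 := by exact_mod_cast hq₀
  refine ((hasDerivAt_cexp_neg_lam q₀ z x).smul ((hu.hasDerivAt_snd x).sub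
    (((hu.hasDerivAt_fst x).const_mul (z / q₀ ^ 2 : ℂ)).smul hq))).congr_deriv ?_
  have hsum : (k q₀ z + lam q₀ z : ℂ) = z := by
    simp only [k, lam]
    push_cast
    ring
  have hfreq : (z / q₀ ^ 2 * (k q₀ z - lam q₀ z) : ℂ) = 1 := by
    simp only [k, lam]
    push_cast
    field_simp
    ring
  set e := exp (I * ↑(-(lam q₀ z * x)))
  simp only [Pi.sub_apply, Pi.smul_apply']
  match_scalars
  · linear_combination (-e * I * f x) * hfreq
  · linear_combination (-e * I) * hsum
  · ring

lemma norm_slow_deriv_le {c : ℂ} {a b y : V} {B M : ℝ} (hc : ‖c‖ ≤ M) (hy : ‖y‖ ≤ M) (ha : ‖a‖ ≤ B)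
    (hb : ‖b‖ ≤ B) (q₀ : ℝ) :
    ‖I • y + (1 / q₀ ^ 2 : ℂ) • (c • b - (I * inner ℂ a y) • a)‖ ≤
      M + 1 / q₀ ^ 2 * (M * B + B * M * B) := by
  have hB : 0 ≤ B := (norm_nonneg a).trans ha
  have hinner : ‖I * inner ℂ a y‖ ≤ B * M := by
    rw [norm_mul, norm_I, one_mul]
    exact (norm_inner_le_norm a y).trans (by gcongr)
  refine (norm_add_le _ _).trans (add_le_add ?_ ?_)
  · rwa [norm_smul, norm_I, one_mul]
  · rw [norm_smul]
    refine mul_le_mul (by simp) ((norm_sub_le _ _).trans ?_) (norm_nonneg _) (by positivity)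
    rw [norm_smul, norm_smul]
    have hM : 0 ≤ M := (norm_nonneg y).trans hy
    gcongr

lemma IsVectorSolution.norm_slow_sub_le (hu : IsVectorSolution q₀ z q f u) (hq₀ : q₀ ≠ 0)
    (hz : 0 < z) (hq : Differentiable ℝ q) {R₁ R₂ B M : ℝ} (hR : R₁ ≤ R₂)
    (hqB : ∀ x ∈ Set.Icc R₁ R₂, ‖q x‖ ≤ B) (hqB' : ∀ x ∈ Set.Icc R₁ R₂, ‖deriv q x‖ ≤ B)
    (hfM : ∀ x ∈ Set.Icc R₁ R₂, ‖f x‖ ≤ M) (huM : ∀ x ∈ Set.Icc R₁ R₂, ‖u x‖ ≤ M) :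
    ‖exp (I * ↑(-(lam q₀ z * R₂))) • u R₂ - exp (I * ↑(-(lam q₀ z * R₁))) • u R₁‖ ≤
      ((M + 1 / q₀ ^ 2 * (M * B + B * M * B)) * (R₂ - R₁) + 2 * (1 / q₀ ^ 2 * M * B)) * z := by
  set e : ℝ → ℂ := fun x => exp (I * ↑(-(lam q₀ z * x)))
  set r : ℝ → V := fun x => e x • (z / q₀ ^ 2 * f x) • q x
  have he (x : ℝ) : ‖e x‖ = 1 := norm_exp_I_mul_ofReal _
  have hzn : ‖(z : ℂ)‖ = z := by simp [hz.le]
  have hmean : ‖(e R₂ • u R₂ - r R₂) - (e R₁ • u R₁ - r R₁)‖ ≤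
      z * (M + 1 / q₀ ^ 2 * (M * B + B * M * B)) * (R₂ - R₁) := by
    simp only [r, ← smul_sub]
    refine norm_image_sub_le_of_norm_deriv_le_segment' (fun x _ =>
      (hu.hasDerivAt_slow hq₀ hz.ne' (hq x).hasDerivAt).hasDerivWithinAt) (fun x hx => ?_) R₂
      ⟨hR, le_rfl⟩
    rw [norm_smul, he, one_mul, norm_neg, norm_smul, hzn]
    have hx' := Set.Ico_subset_Icc_self hx
    gcongr
    exact norm_slow_deriv_le (hfM x hx') (huM x hx') (hqB x hx') (hqB' x hx') q₀
  have hr (x) (hx : x ∈ Set.Icc R₁ R₂) : ‖r x‖ ≤ z * (1 / q₀ ^ 2 * M * B) := by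
    have hM : 0 ≤ M := (norm_nonneg _).trans (hfM x hx)
    calc ‖r x‖
      _ = z * (1 / q₀ ^ 2 * ‖f x‖ * ‖q x‖) := by
        simp only [r, norm_smul, he, norm_mul, norm_div, hzn, norm_pow, norm_real, sq_abs,
          Real.norm_eq_abs]
        ring
      _ ≤ z * (1 / q₀ ^ 2 * M * B) := by
        gcongr
        exacts [hfM x hx, hqB x hx]
  calc ‖e R₂ • u R₂ - e R₁ • u R₁‖
    _ = ‖((e R₂ • u R₂ - r R₂) - (e R₁ • u R₁ - r R₁)) + r R₂ - r R₁‖ := by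
      congr 1
      abel
    _ ≤ z * (M + 1 / q₀ ^ 2 * (M * B + B * M * B)) * (R₂ - R₁) + z * (1 / q₀ ^ 2 * M * B) +
          z * (1 / q₀ ^ 2 * M * B) :=
      (norm_sub_le _ _).trans (add_le_add ((norm_add_le _ _).trans
        (add_le_add hmean (hr R₂ ⟨hR, le_rfl⟩))) (hr R₁ ⟨le_rfl, hR⟩))
    _ = _ := by ring

lemma exists_norm_slow_sub_le (hq₀ : q₀ ≠ 0) (hq : ContDiff ℝ 1 q) {R₁ R₂ : ℝ} (hR : R₁ ≤ R₂)
    (M : ℝ) :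
    ∃ C, ∀ z > 0, ∀ (f : ℝ → ℂ) (u : ℝ → V), IsVectorSolution q₀ z q f u →
      (∀ x ∈ Set.Icc R₁ R₂, ‖f x‖ ≤ M) → (∀ x ∈ Set.Icc R₁ R₂, ‖u x‖ ≤ M) →
      ‖exp (I * ↑(-(lam q₀ z * R₂))) • u R₂ - exp (I * ↑(-(lam q₀ z * R₁))) • u R₁‖ ≤ C * z := by
  obtain ⟨B, hB⟩ := isCompact_Icc.exists_bound_of_continuousOn (s := Set.Icc R₁ R₂)
    (hq.continuous.prodMk (hq.continuous_deriv le_rfl)).continuousOn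
  exact ⟨_, fun z hz f u hu hfM huM => hu.norm_slow_sub_le hq₀ hz (hq.differentiable one_ne_zero)
    hR (fun x hx => (norm_fst_le _).trans (hB x hx)) (fun x hx => (norm_snd_le _).trans (hB x hx))
    hfM huM⟩

lemma sq_norm_sub_norm_inner_le (x y : V) {c : ℂ} (hc : ‖c‖ = 1) :
    ‖x‖ ^ 2 - ‖inner ℂ x y‖ ≤ ‖x‖ * ‖x - c • y‖ := by
  have hsplit : inner ℂ x x = c * inner ℂ x y + inner ℂ x (x - c • y) := by
    rw [inner_sub_right, inner_smul_right]
    ring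
  have hnorm := norm_add_le (c * inner ℂ x y) (inner ℂ x (x - c • y))
  rw [← hsplit, norm_mul, hc, one_mul, inner_self_eq_norm_sq_to_K] at hnorm
  simp only [coe_algebraMap, norm_pow, norm_real, norm_norm] at hnorm
  linarith [norm_inner_le_norm (𝕜 := ℂ) x (x - c • y)]

end SlowComponents

open Matrix
open scoped Matrix.Norms.L2Operator

lemma hasDerivAt_matrix {m n : ℕ} {ψ : ℝ → Matrix (Fin m) (Fin n) ℂ}
    {ψ' : Matrix (Fin m) (Fin n) ℂ} {x : ℝ} :
    HasDerivAt ψ ψ' x ↔ ∀ i j, HasDerivAt (fun y => ψ y i j) (ψ' i j) x :=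
  hasDerivAt_pi.trans (forall_congr' fun _ => hasDerivAt_pi)

section Eigenvectors

variable {σ q₀ z t : ℝ} {v : EuclideanSpace ℂ (Fin 2)}

/-- Eigenvectors of `X q₀ z v`, normalized so that, unlike the columns of `Y q₀ z v`, they stay
bounded and independent as `z → 0`. -/
def eigenbasis (q₀ z : ℝ) (v : EuclideanSpace ℂ (Fin 2)) : Matrix (Fin 3) (Fin 3) ℂ :=
  !![(z : ℂ), 0, q₀;
     v 0, perp v 0, z * v 0 / q₀;
     v 1, perp v 1, z * v 1 / q₀]

/-- The factors between the columns of `eigenbasis` and those of `Y`. -/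
def scale (q₀ z : ℝ) : Fin 3 → ℂ := ![rho q₀ z * I / z, 1 / q₀, rho q₀ z / z]

/-- The eigenvalues of `X q₀ z v`, divided by `i`. -/
def freq (q₀ z : ℝ) : Fin 3 → ℝ := ![lam q₀ z, -k q₀ z, -lam q₀ z]

/-- The diagonal of the phase matrix `Δ`. -/
def phase (σ q₀ z x t : ℝ) : Fin 3 → ℝ :=
  ![delta₁ σ q₀ z x t, delta₂ σ q₀ z x t, -delta₁ σ q₀ z x t]

/-- The values of the indefinite form `u ↦ u† J u` on the columns of `eigenbasis`. -/
def eigenNorm (q₀ z : ℝ) : Fin 3 → ℂ :=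
  ![(z ^ 2 - q₀ ^ 2 : ℂ), -(q₀ ^ 2 : ℂ), (q₀ ^ 2 - z ^ 2 : ℂ)]

lemma conj_mul_add_conj_mul (hv : ‖v‖ = q₀) :
    starRingEnd ℂ (v 0) * v 0 + starRingEnd ℂ (v 1) * v 1 = (q₀ ^ 2 : ℂ) := by
  rw [conj_mul', conj_mul', ← hv]
  exact_mod_cast (EuclideanSpace.norm_sq_eq v ▸ Fin.sum_univ_two _).symm

lemma J_eq : J = !![1, 0, 0; 0, -1, 0; 0, 0, -1] := by
  ext i j
  fin_cases i <;> fin_cases j <;> simp [J]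

lemma X_eq (w : EuclideanSpace ℂ (Fin 2)) : X q₀ z w =
    !![I * k q₀ z, -(I * star (w 0)), -(I * star (w 1));
       I * w 0, -(I * k q₀ z), 0;
       I * w 1, 0, -(I * k q₀ z)] := by
  ext i j
  fin_cases i <;> fin_cases j <;> simp [X, Q, J_eq]

lemma X_conjTranspose_mul_J (w : EuclideanSpace ℂ (Fin 2)) :
    (X q₀ z w)ᴴ * J + J * X q₀ z w = 0 := by
  ext i j
  fin_cases i <;> fin_cases j <;>
    simp [X_eq, J_eq, mul_apply, Fin.sum_univ_three]

lemma X_mul_eigenbasis (hq₀ : q₀ ≠ 0) (hv : ‖v‖ = q₀) (hz : z ≠ 0) :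
    X q₀ z v * eigenbasis q₀ z v =
      eigenbasis q₀ z v * diagonal (fun j => I * (freq q₀ z j : ℂ)) := by
  have hv' := conj_mul_add_conj_mul hv
  have hz' : (z : ℂ) ≠ 0 := by exact_mod_cast hz
  have hq' : (q₀ : ℂ) ≠ 0 := by exact_mod_cast hq₀
  have hk : (k q₀ z : ℂ) = (z + q₀ ^ 2 / z) / 2 := by simp [k]
  have hl : (lam q₀ z : ℂ) = (z - q₀ ^ 2 / z) / 2 := by simp [lam]
  ext i j
  fin_cases i <;> fin_cases j <;>
    simp [X_eq, eigenbasis, freq, mul_apply, Fin.sum_univ_three, diagonal, perp,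
      hk, hl] <;> field_simp <;> grind

lemma eigenbasis_conjTranspose_mul (hq₀ : q₀ ≠ 0) (hv : ‖v‖ = q₀) :
    (eigenbasis q₀ z v)ᴴ * J * eigenbasis q₀ z v = diagonal (eigenNorm q₀ z) := by
  have hv' := conj_mul_add_conj_mul hv
  have hq' : (q₀ : ℂ) ≠ 0 := by exact_mod_cast hq₀
  ext i j
  fin_cases i <;> fin_cases j <;>
    simp [eigenbasis, J_eq, eigenNorm, mul_apply, Fin.sum_univ_three, diagonal, perp]
      <;> field_simp <;> grind

lemma eigenbasis_mul_diagonal_scale (hq₀ : q₀ ≠ 0) (hz : z ≠ 0) :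
    eigenbasis q₀ z v * diagonal (scale q₀ z) = Y q₀ z v := by
  have hz' : (z : ℂ) ≠ 0 := by exact_mod_cast hz
  have hq' : (q₀ : ℂ) ≠ 0 := by exact_mod_cast hq₀
  ext i j
  fin_cases i <;> fin_cases j <;>
    simp [Y, eigenbasis, scale, perp] <;> field_simp

lemma sq_sub_sq_ne_zero (h1 : z ≠ q₀) (h2 : z ≠ -q₀) : (z ^ 2 - q₀ ^ 2 : ℂ) ≠ 0 := by
  have h : z ^ 2 - q₀ ^ 2 ≠ 0 := sub_ne_zero.2 (by simp [sq_eq_sq_iff_eq_or_eq_neg, h1, h2])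
  exact_mod_cast h

lemma eigenNorm_ne_zero (hq₀ : q₀ ≠ 0) (h1 : z ≠ q₀) (h2 : z ≠ -q₀) (j : Fin 3) :
    eigenNorm q₀ z j ≠ 0 := by
  have h := sq_sub_sq_ne_zero h1 h2
  have h' := neg_ne_zero.2 h
  fin_cases j <;> simp_all [eigenNorm]

lemma scale_ne_zero (hq₀ : q₀ ≠ 0) (hz : z ≠ 0) (h1 : z ≠ q₀) (h2 : z ≠ -q₀) (j : Fin 3) :
    scale q₀ z j ≠ 0 := by
  have hz' : (z : ℂ) ≠ 0 := by exact_mod_cast hz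
  have h := sq_sub_sq_ne_zero h1 h2
  fin_cases j <;> simp [scale, rho, hq₀, hz', h]

lemma norm_J_le : ‖J‖ ≤ 1 := by
  rw [J, l2_opNorm_diagonal, pi_norm_le_iff_of_nonneg zero_le_one]
  intro j
  fin_cases j <;> simp

lemma phase_eq (σ q₀ z x t : ℝ) (j : Fin 3) :
    phase σ q₀ z x t j = freq q₀ z j * x + phase σ q₀ z 0 t j := by
  fin_cases j <;> simp [phase, freq, delta₁, delta₂] <;> ring

lemma expIDelta_eq (σ q₀ z x t : ℝ) :
    expIDelta σ q₀ z x t = diagonal fun j => exp (I * (phase σ q₀ z x t j : ℂ)) := by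
  rw [expIDelta, diagonal_eq_diagonal_iff]
  intro j
  fin_cases j <;> simp [phase]

lemma norm_expIDelta_le (σ q₀ z x t : ℝ) : ‖expIDelta σ q₀ z x t‖ ≤ 1 := by
  rw [expIDelta_eq, l2_opNorm_diagonal, pi_norm_le_iff_of_nonneg zero_le_one]
  exact fun j => (norm_exp_I_mul_ofReal _).le

lemma expIDelta_conjTranspose_mul_diagonal_mul (d : Fin 3 → ℂ) (x : ℝ) :
    (expIDelta σ q₀ z x t)ᴴ * diagonal d * expIDelta σ q₀ z x t = diagonal d := by
  rw [expIDelta_eq, diagonal_conjTranspose, diagonal_mul_diagonal, diagonal_mul_diagonal,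
    diagonal_eq_diagonal_iff]
  intro j
  rw [mul_right_comm, Pi.star_apply, RCLike.star_def, conj_mul', norm_exp_I_mul_ofReal]
  simp

lemma hasDerivAt_expIDelta (x : ℝ) :
    HasDerivAt (fun x => expIDelta σ q₀ z x t)
      (diagonal (fun j => I * (freq q₀ z j : ℂ)) * expIDelta σ q₀ z x t) x := by
  simp only [expIDelta_eq, diagonal_mul_diagonal, hasDerivAt_matrix, diagonal_apply]
  intro i j
  split_ifs
  · have hphase : HasDerivAt (fun y => phase σ q₀ z y t i) (freq q₀ z i) x := by
      rw [funext fun y => phase_eq σ q₀ z y t i]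
      simpa using ((hasDerivAt_id x).const_mul (freq q₀ z i)).add_const (phase σ q₀ z 0 t i)
    exact (hphase.ofReal_comp.const_mul I).cexp.congr_deriv (mul_comm _ _)
  · exact hasDerivAt_const x 0

/-- The eigensolution `x ↦ eigenbasis q₀ z v * e^{iΔ}` of the problem with constant potential `v`,
which is `Y q₀ z v * e^{iΔ}` up to the factors `scale`. -/
def planeWave (σ q₀ z t : ℝ) (v : EuclideanSpace ℂ (Fin 2)) (x : ℝ) : Matrix (Fin 3) (Fin 3) ℂ :=
  eigenbasis q₀ z v * expIDelta σ q₀ z x t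

lemma planeWave_mul_diagonal_scale (hq₀ : q₀ ≠ 0) (hz : z ≠ 0) (x : ℝ) :
    planeWave σ q₀ z t v x * diagonal (scale q₀ z) = Y q₀ z v * expIDelta σ q₀ z x t := by
  rw [planeWave, Matrix.mul_assoc, expIDelta, (commute_diagonal _ _).eq, ← Matrix.mul_assoc,
    eigenbasis_mul_diagonal_scale hq₀ hz]

lemma hasDerivAt_planeWave (hq₀ : q₀ ≠ 0) (hv : ‖v‖ = q₀) (hz : z ≠ 0) (x : ℝ) :
    HasDerivAt (planeWave σ q₀ z t v) (X q₀ z v * planeWave σ q₀ z t v x) x := by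
  refine ((hasDerivAt_expIDelta x).const_mul (eigenbasis q₀ z v)).congr_deriv ?_
  rw [planeWave, ← Matrix.mul_assoc, ← Matrix.mul_assoc, X_mul_eigenbasis hq₀ hv hz]

lemma planeWave_conjTranspose_mul (hq₀ : q₀ ≠ 0) (hv : ‖v‖ = q₀) (x : ℝ) :
    (planeWave σ q₀ z t v x)ᴴ * J * planeWave σ q₀ z t v x = diagonal (eigenNorm q₀ z) :=
  calc (planeWave σ q₀ z t v x)ᴴ * J * planeWave σ q₀ z t v x
    _ = (expIDelta σ q₀ z x t)ᴴ * ((eigenbasis q₀ z v)ᴴ * J * eigenbasis q₀ z v) *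
          expIDelta σ q₀ z x t := by
      simp only [planeWave, conjTranspose_mul, Matrix.mul_assoc]
    _ = diagonal (eigenNorm q₀ z) := by
      rw [eigenbasis_conjTranspose_mul hq₀ hv, expIDelta_conjTranspose_mul_diagonal_mul]

lemma norm_planeWave_le (x : ℝ) : ‖planeWave σ q₀ z t v x‖ ≤ ‖eigenbasis q₀ z v‖ :=
  (l2_opNorm_mul _ _).trans
    (mul_le_of_le_one_right (norm_nonneg _) (norm_expIDelta_le σ q₀ z x t))

end Eigenvectors

section Jost

variable {σ q₀ z t : ℝ} {w : ℝ → EuclideanSpace ℂ (Fin 2)} {v : EuclideanSpace ℂ (Fin 2)}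
  {l : Filter ℝ} {S : ℝ → Set ℝ} {ψ φ : ℝ → Matrix (Fin 3) (Fin 3) ℂ}

/-- `ψ` is a matrix solution of the scattering problem `ψ_x = X ψ` with potential `w`. -/
def IsMatrixSolution (q₀ z : ℝ) (w : ℝ → EuclideanSpace ℂ (Fin 2))
    (ψ : ℝ → Matrix (Fin 3) (Fin 3) ℂ) : Prop :=
  ∀ x, HasDerivAt ψ (X q₀ z (w x) * ψ x) x

lemma IsMatrixSolution.mul_right (h : IsMatrixSolution q₀ z w ψ) (C : Matrix (Fin 3) (Fin 3) ℂ) :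
    IsMatrixSolution q₀ z w fun x => ψ x * C := fun x =>
  ((h x).mul_const C).congr_deriv (Matrix.mul_assoc _ _ _)

lemma IsMatrixSolution.conjTranspose_mul_eq (hψ : IsMatrixSolution q₀ z w ψ)
    (hφ : IsMatrixSolution q₀ z w φ) (x y : ℝ) :
    (ψ x)ᴴ * J * φ x = (ψ y)ᴴ * J * φ y := by
  have hderiv (s : ℝ) : HasDerivAt (fun r => (ψ r)ᴴ * J * φ r) 0 s := by
    refine (((hψ s).star.mul_const J).mul (hφ s)).congr_deriv ?_
    calc (X q₀ z (w s) * ψ s)ᴴ * J * φ s + (ψ s)ᴴ * J * (X q₀ z (w s) * φ s)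
      _ = (ψ s)ᴴ * ((X q₀ z (w s))ᴴ * J + J * X q₀ z (w s)) * φ s := by
        rw [conjTranspose_mul]; noncomm_ring
      _ = 0 := by rw [X_conjTranspose_mul_J, Matrix.mul_zero, Matrix.zero_mul]
  exact is_const_of_deriv_eq_zero (fun s => (hderiv s).differentiableAt)
    (fun s => (hderiv s).deriv) x y

/-- `ψ` is a matrix solution of the scattering problem asymptotic to the plane wave with the
boundary value `v` along `l`; it is a Jost solution with its columns divided by `scale`. -/
structure IsDistortedPlaneWave (σ q₀ z t : ℝ) (w : ℝ → EuclideanSpace ℂ (Fin 2)) (l : Filter ℝ)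
    (v : EuclideanSpace ℂ (Fin 2)) (ψ : ℝ → Matrix (Fin 3) (Fin 3) ℂ) : Prop where
  isMatrixSolution : IsMatrixSolution q₀ z w ψ
  tendsto : Tendsto (fun x => ψ x - planeWave σ q₀ z t v x) l (𝓝 0)

lemma diagonal_inv_mul_diagonal {n : Type*} [Fintype n] [DecidableEq n] {d : n → ℂ}
    (hd : ∀ j, d j ≠ 0) : diagonal d⁻¹ * diagonal d = 1 := by
  rw [diagonal_mul_diagonal, ← diagonal_one, diagonal_eq_diagonal_iff]
  exact fun j => inv_mul_cancel₀ (hd j)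

lemma diagonal_inv_mul_conjTranspose_mul {n : Type*} [Fintype n] [DecidableEq n] {d : n → ℂ}
    (hd : ∀ j, d j ≠ 0) {A B C : Matrix n n ℂ} (h : Aᴴ * B * C = diagonal d) :
    diagonal d⁻¹ * Aᴴ * B * C = 1 := by
  rw [← diagonal_inv_mul_diagonal hd, ← h]
  simp only [Matrix.mul_assoc]

lemma IsDistortedPlaneWave.conjTranspose_mul (hl : l.NeBot) (hq₀ : q₀ ≠ 0) (hv : ‖v‖ = q₀)
    (hψ : IsDistortedPlaneWave σ q₀ z t w l v ψ) (hφ : IsDistortedPlaneWave σ q₀ z t w l v φ)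
    (x : ℝ) : (ψ x)ᴴ * J * φ x = diagonal (eigenNorm q₀ z) := by
  set F := planeWave σ q₀ z t v
  have hbdd : IsBoundedUnder (· ≤ ·) l fun y => ‖J * F y‖ :=
    isBoundedUnder_of ⟨‖J‖ * ‖eigenbasis q₀ z v‖, fun y => (l2_opNorm_mul _ _).trans
      (mul_le_mul_of_nonneg_left (norm_planeWave_le y) (norm_nonneg _))⟩
  have hbdd' : IsBoundedUnder (· ≤ ·) l fun y => ‖(F y)ᴴ * J‖ :=
    isBoundedUnder_of ⟨‖eigenbasis q₀ z v‖ * ‖J‖, fun y => (l2_opNorm_mul _ _).trans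
      (mul_le_mul_of_nonneg_right ((l2_opNorm_conjTranspose _).trans_le (norm_planeWave_le y))
        (norm_nonneg _))⟩
  have hψ' : Tendsto (fun y => (ψ y - F y)ᴴ) l (𝓝 0) := by
    simpa [star_eq_conjTranspose] using hψ.tendsto.star
  have hlim : Tendsto (fun y => (ψ y)ᴴ * J * φ y - (F y)ᴴ * J * F y) l (𝓝 0) := by
    have h := ((hψ'.mul_const J).mul hφ.tendsto).add
      ((hψ'.zero_mul_isBoundedUnder_le hbdd).add
        (isBoundedUnder_le_mul_tendsto_zero hbdd' hφ.tendsto))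
    simp only [zero_mul, add_zero] at h
    refine h.congr fun y => ?_
    rw [conjTranspose_sub]
    noncomm_ring
  refine sub_eq_zero.1 (tendsto_nhds_unique (tendsto_const_nhds.congr fun y => ?_) hlim)
  rw [planeWave_conjTranspose_mul hq₀ hv,
    hψ.isMatrixSolution.conjTranspose_mul_eq hφ.isMatrixSolution x y]

lemma IsDistortedPlaneWave.unique (hl : l.NeBot) (hq₀ : q₀ ≠ 0) (hv : ‖v‖ = q₀) (h1 : z ≠ q₀)
    (h2 : z ≠ -q₀) (hψ : IsDistortedPlaneWave σ q₀ z t w l v ψ)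
    (hφ : IsDistortedPlaneWave σ q₀ z t w l v φ) : ψ = φ := by
  have hd := eigenNorm_ne_zero hq₀ h1 h2
  have hleft {χ} (hχ : IsDistortedPlaneWave σ q₀ z t w l v χ) (x : ℝ) :=
    diagonal_inv_mul_conjTranspose_mul hd (hψ.conjTranspose_mul hl hq₀ hv hχ x)
  ext1 x
  exact (left_inv_eq_right_inv (mul_eq_one_comm.1 (hleft hψ x)) (hleft hφ x) :)

lemma X_sub_X (w v : EuclideanSpace ℂ (Fin 2)) : X q₀ z w - X q₀ z v = I • Q (w - v) := by
  ext i j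
  fin_cases i <;> fin_cases j <;> simp [X_eq, Q] <;> ring

lemma exists_continuousLinearMap_eq_Q :
    ∃ L : EuclideanSpace ℂ (Fin 2) →L[ℝ] Matrix (Fin 3) (Fin 3) ℂ, ∀ u, L u = Q u := by
  let L : EuclideanSpace ℂ (Fin 2) →ₗ[ℝ] Matrix (Fin 3) (Fin 3) ℂ :=
    { toFun := Q
      map_add' u v := by
        ext i j
        fin_cases i <;> fin_cases j <;> simp [Q] <;> ring
      map_smul' c u := by
        ext i j
        fin_cases i <;> fin_cases j <;> simp [Q] }
  exact ⟨L.toContinuousLinearMap, fun _ => rfl⟩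

lemma continuous_Q : Continuous Q := by
  obtain ⟨L, hL⟩ := exists_continuousLinearMap_eq_Q
  exact L.continuous.congr hL

lemma integrableOn_Q {s : Set ℝ} {u : ℝ → EuclideanSpace ℂ (Fin 2)} (hu : IntegrableOn u s) :
    IntegrableOn (fun x => Q (u x)) s := by
  obtain ⟨L, hL⟩ := exists_continuousLinearMap_eq_Q
  exact (L.integrable_comp hu).congr (.of_forall fun x => hL (u x))

/-- The potential of the scattering problem in the frame of the plane wave. -/
def perturbation (σ q₀ z t : ℝ) (w : ℝ → EuclideanSpace ℂ (Fin 2))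
    (v : EuclideanSpace ℂ (Fin 2)) (x : ℝ) : Matrix (Fin 3) (Fin 3) ℂ :=
  diagonal (eigenNorm q₀ z)⁻¹ * (planeWave σ q₀ z t v x)ᴴ * J * (I • Q (w x - v)) *
    planeWave σ q₀ z t v x

lemma planeWave_mul_perturbation (hq₀ : q₀ ≠ 0) (hv : ‖v‖ = q₀) (h1 : z ≠ q₀) (h2 : z ≠ -q₀)
    (x : ℝ) : planeWave σ q₀ z t v x * perturbation σ q₀ z t w v x =
      (X q₀ z (w x) - X q₀ z v) * planeWave σ q₀ z t v x := by
  have hinv := mul_eq_one_comm.1 (diagonal_inv_mul_conjTranspose_mul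
    (eigenNorm_ne_zero hq₀ h1 h2) (planeWave_conjTranspose_mul (σ := σ) (t := t) hq₀ hv x))
  rw [perturbation, X_sub_X, ← Matrix.mul_assoc, ← Matrix.mul_assoc, hinv, Matrix.one_mul]

lemma continuous_perturbation (hq₀ : q₀ ≠ 0) (hv : ‖v‖ = q₀) (hz : z ≠ 0) (hw : Continuous w) :
    Continuous (perturbation σ q₀ z t w v) := by
  have hF : Continuous (planeWave σ q₀ z t v) :=
    continuous_iff_continuousAt.2 fun x => (hasDerivAt_planeWave hq₀ hv hz x).continuousAt
  have hQ : Continuous fun x => Q (w x - v) := continuous_Q.comp (hw.sub continuous_const)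
  unfold perturbation
  fun_prop

lemma norm_perturbation_le {K : ℝ} (hK : ‖eigenbasis q₀ z v‖ ≤ K)
    (hK' : ‖diagonal (eigenNorm q₀ z)⁻¹‖ ≤ K) (x : ℝ) :
    ‖perturbation σ q₀ z t w v x‖ ≤ K ^ 3 * ‖Q (w x - v)‖ := by
  have hF : ‖planeWave σ q₀ z t v x‖ ≤ K := (norm_planeWave_le x).trans hK
  have hK0 : 0 ≤ K := (norm_nonneg _).trans hK
  calc ‖perturbation σ q₀ z t w v x‖
    _ ≤ ‖diagonal (eigenNorm q₀ z)⁻¹‖ * ‖(planeWave σ q₀ z t v x)ᴴ‖ * ‖J‖ *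
          ‖I • Q (w x - v)‖ * ‖planeWave σ q₀ z t v x‖ :=
      norm_mul₃_le.trans (by gcongr; exact norm_mul₃_le)
    _ = ‖diagonal (eigenNorm q₀ z)⁻¹‖ * ‖planeWave σ q₀ z t v x‖ * ‖J‖ *
          ‖Q (w x - v)‖ * ‖planeWave σ q₀ z t v x‖ := by
      rw [l2_opNorm_conjTranspose, norm_smul, norm_I, one_mul]
    _ ≤ K * K * 1 * ‖Q (w x - v)‖ * K := by
      gcongr
      exact norm_J_le
    _ = K ^ 3 * ‖Q (w x - v)‖ := by ring

lemma exists_isDistortedPlaneWave (hl : IsEnd l S) (hq₀ : q₀ ≠ 0) (hv : ‖v‖ = q₀) (hz : z ≠ 0)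
    (h1 : z ≠ q₀) (h2 : z ≠ -q₀) (hw : Continuous w)
    (hint : IntegrableAtFilter (fun y => w y - v) l) {K : ℝ}
    (hK : ‖eigenbasis q₀ z v‖ ≤ K) (hK' : ‖diagonal (eigenNorm q₀ z)⁻¹‖ ≤ K) :
    ∃ ψ, IsDistortedPlaneWave σ q₀ z t w l v ψ ∧ ∀ x, ‖ψ x - planeWave σ q₀ z t v x‖ ≤
      K * (Real.exp (K ^ 3 * ∫ y in S x, ‖Q (w y - v)‖) - 1) := by
  set F := planeWave σ q₀ z t v
  set a := perturbation σ q₀ z t w v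
  have ha : Continuous a := continuous_perturbation hq₀ hv hz hw
  have hbound (x : ℝ) : IntegrableOn (fun y => K ^ 3 * ‖Q (w y - v)‖) (S x) :=
    (integrableOn_Q (hl.integrableOn (hw.sub continuous_const) hint x)).norm.const_mul _
  have haint (x : ℝ) : IntegrableOn a (S x) :=
    (hbound x).mono' ha.aestronglyMeasurable (.of_forall (norm_perturbation_le hK hK'))
  obtain ⟨g, hg, hg1⟩ := hl.exists_hasDerivAt_mul_norm_sub_le ha haint 1
  have hle (x : ℝ) :
      ‖F x * g x - F x‖ ≤ K * (Real.exp (K ^ 3 * ∫ y in S x, ‖Q (w y - v)‖) - 1) :=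
    calc ‖F x * g x - F x‖
      _ ≤ ‖F x‖ * ‖g x - 1‖ := by
        rw [← mul_sub_one]
        exact norm_mul_le _ _
      _ ≤ K * (Real.exp (∫ y in S x, ‖a y‖) - 1) := by
        refine mul_le_mul ((norm_planeWave_le x).trans hK) ?_ (norm_nonneg _)
          ((norm_nonneg _).trans hK)
        simpa using hg1 x
      _ ≤ K * (Real.exp (K ^ 3 * ∫ y in S x, ‖Q (w y - v)‖) - 1) := by
        have hK0 : 0 ≤ K := (norm_nonneg _).trans hK
        rw [← integral_const_mul]
        gcongr ?_ * (Real.exp ?_ - 1)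
        exact integral_mono (haint x).norm (hbound x) (norm_perturbation_le hK hK')
  refine ⟨fun x => F x * g x, ⟨fun x => ?_, ?_⟩, hle⟩
  · refine ((hasDerivAt_planeWave hq₀ hv hz x).mul (hg x)).congr_deriv ?_
    rw [← Matrix.mul_assoc (F x), planeWave_mul_perturbation hq₀ hv h1 h2]
    noncomm_ring
  · refine squeeze_zero_norm hle ?_
    have h := ((hl.tendsto_integral fun y => ‖Q (w y - v)‖).const_mul (K ^ 3)).rexp
    simpa using (h.sub_const 1).const_mul K

lemma IsJost.isMatrixSolution {q : ℝ → ℝ → EuclideanSpace ℂ (Fin 2)}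
    (hψ : IsJost σ q₀ q t z l v ψ) : IsMatrixSolution q₀ z (fun x => q x t) ψ :=
  fun x => hasDerivAt_matrix.2 (hψ.hasDerivAt x)

lemma isJost_iff (hq₀ : q₀ ≠ 0) (hz : z ≠ 0) (h1 : z ≠ q₀) (h2 : z ≠ -q₀)
    {q : ℝ → ℝ → EuclideanSpace ℂ (Fin 2)} :
    IsJost σ q₀ q t z l v ψ ↔ IsDistortedPlaneWave σ q₀ z t (fun x => q x t) l v
      fun x => ψ x * diagonal (scale q₀ z)⁻¹ := by
  have hd := scale_ne_zero hq₀ hz h1 h2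
  have hinv := diagonal_inv_mul_diagonal hd
  have hinv' := mul_eq_one_comm.1 hinv
  refine ⟨fun h => ⟨h.isMatrixSolution.mul_right _, ?_⟩,
    fun h => ⟨fun x => hasDerivAt_matrix.1 ?_, ?_⟩⟩
  · have hlim : Tendsto _ l (𝓝 _) := Tendsto.mul_const (diagonal (scale q₀ z)⁻¹) h.tendsto
    rw [zero_mul] at hlim
    refine hlim.congr fun x => ?_
    rw [sub_mul, ← planeWave_mul_diagonal_scale hq₀ hz, Matrix.mul_assoc (planeWave σ q₀ z t v x),
      hinv', Matrix.mul_one]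
  · simpa [Matrix.mul_assoc, hinv] using
      h.isMatrixSolution.mul_right (diagonal (scale q₀ z)) x
  · have hlim := h.tendsto.mul_const (diagonal (scale q₀ z))
    rw [zero_mul] at hlim
    refine Tendsto.congr (fun x => ?_) hlim
    rw [sub_mul, planeWave_mul_diagonal_scale hq₀ hz, Matrix.mul_assoc (ψ x), hinv,
      Matrix.mul_one]

lemma exists_isJost (hl : IsEnd l S) (hq₀ : q₀ ≠ 0) (hv : ‖v‖ = q₀) (hz : z ≠ 0) (h1 : z ≠ q₀)
    (h2 : z ≠ -q₀) {q : ℝ → ℝ → EuclideanSpace ℂ (Fin 2)} (hq : Continuous fun x => q x t)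
    (hint : IntegrableAtFilter (fun x => q x t - v) l) : ∃ ψ, IsJost σ q₀ q t z l v ψ := by
  obtain ⟨φ, hφ, -⟩ := exists_isDistortedPlaneWave (σ := σ) hl hq₀ hv hz h1 h2 hq hint
    (le_max_left _ _) (le_max_right _ _)
  refine ⟨fun x => φ x * diagonal (scale q₀ z), (isJost_iff hq₀ hz h1 h2).2 ?_⟩
  simpa [Matrix.mul_assoc, mul_eq_one_comm.1 (diagonal_inv_mul_diagonal
    (scale_ne_zero hq₀ hz h1 h2))] using hφ

/-- The values of the indefinite form `u ↦ u† J u` on the columns of the Jost solutions. -/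
def jostNorm (q₀ z : ℝ) (j : Fin 3) : ℂ := star (scale q₀ z j) * eigenNorm q₀ z j * scale q₀ z j

lemma jostNorm_ne_zero (hq₀ : q₀ ≠ 0) (hz : z ≠ 0) (h1 : z ≠ q₀) (h2 : z ≠ -q₀) (j : Fin 3) :
    jostNorm q₀ z j ≠ 0 := by
  have hd := scale_ne_zero hq₀ hz h1 h2 j
  exact mul_ne_zero (mul_ne_zero (star_ne_zero.2 hd) (eigenNorm_ne_zero hq₀ h1 h2 j)) hd

lemma IsJost.conjTranspose_mul (hl : l.NeBot) (hq₀ : q₀ ≠ 0) (hv : ‖v‖ = q₀) (hz : z ≠ 0)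
    (h1 : z ≠ q₀) (h2 : z ≠ -q₀) {q : ℝ → ℝ → EuclideanSpace ℂ (Fin 2)}
    (hψ : IsJost σ q₀ q t z l v ψ) (hφ : IsJost σ q₀ q t z l v φ) (x : ℝ) :
    (ψ x)ᴴ * J * φ x = diagonal (jostNorm q₀ z) := by
  have hinv := diagonal_inv_mul_diagonal (scale_ne_zero hq₀ hz h1 h2)
  have h := ((isJost_iff hq₀ hz h1 h2).1 hψ).conjTranspose_mul hl hq₀ hv
    ((isJost_iff hq₀ hz h1 h2).1 hφ) x
  calc (ψ x)ᴴ * J * φ x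
    _ = (ψ x * diagonal (scale q₀ z)⁻¹ * diagonal (scale q₀ z))ᴴ * J *
          (φ x * diagonal (scale q₀ z)⁻¹ * diagonal (scale q₀ z)) := by
      simp only [Matrix.mul_assoc, hinv, Matrix.mul_one]
    _ = (diagonal (scale q₀ z))ᴴ *
          ((ψ x * diagonal (scale q₀ z)⁻¹)ᴴ * J * (φ x * diagonal (scale q₀ z)⁻¹)) *
          diagonal (scale q₀ z) := by
      rw [Matrix.conjTranspose_mul (_ * _)]
      simp only [Matrix.mul_assoc]
    _ = diagonal (jostNorm q₀ z) := by
      rw [h, diagonal_conjTranspose, diagonal_mul_diagonal, diagonal_mul_diagonal]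
      rfl

lemma IsJost.unique (hl : l.NeBot) (hq₀ : q₀ ≠ 0) (hv : ‖v‖ = q₀) (hz : z ≠ 0) (h1 : z ≠ q₀)
    (h2 : z ≠ -q₀) {q : ℝ → ℝ → EuclideanSpace ℂ (Fin 2)} (hψ : IsJost σ q₀ q t z l v ψ)
    (hφ : IsJost σ q₀ q t z l v φ) : ψ = φ := by
  have heq := ((isJost_iff hq₀ hz h1 h2).1 hψ).unique hl hq₀ hv h1 h2
    ((isJost_iff hq₀ hz h1 h2).1 hφ)
  have hinv := diagonal_inv_mul_diagonal (scale_ne_zero hq₀ hz h1 h2)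
  ext1 x
  simpa [Matrix.mul_assoc, hinv] using congr($heq x * diagonal (scale q₀ z))

end Jost

section Scattering

variable {σ q₀ z t : ℝ} {q : ℝ → ℝ → EuclideanSpace ℂ (Fin 2)} {qm qp : EuclideanSpace ℂ (Fin 2)}
  {H : Matrix (Fin 3) (Fin 3) ℂ}

theorem existsUnique_isScatteringMatrix (hq₀ : q₀ ≠ 0) (hqm : ‖qm‖ = q₀) (hqp : ‖qp‖ = q₀)
    (hz : z ≠ 0) (h1 : z ≠ q₀) (h2 : z ≠ -q₀) (hq : Continuous fun x => q x t)
    (hm : IntegrableAtFilter (fun x => q x t - qm) atBot)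
    (hp : IntegrableAtFilter (fun x => q x t - qp) atTop) :
    ∃! H, IsScatteringMatrix σ q₀ qm qp q t z H := by
  obtain ⟨ψm, hψm⟩ := exists_isJost (σ := σ) .bot hq₀ hqm hz h1 h2 hq hm
  obtain ⟨ψp, hψp⟩ := exists_isJost (σ := σ) .top hq₀ hqp hz h1 h2 hq hp
  have hleft (x : ℝ) := diagonal_inv_mul_conjTranspose_mul (jostNorm_ne_zero hq₀ hz h1 h2)
    (hψm.conjTranspose_mul inferInstance hq₀ hqm hz h1 h2 hψm x)
  refine ⟨diagonal (jostNorm q₀ z)⁻¹ * ((ψm 0)ᴴ * J * ψp 0), ⟨ψm, ψp, hψm, hψp, fun x => ?_⟩, ?_⟩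
  · calc ψp x
      _ = ψm x * (diagonal (jostNorm q₀ z)⁻¹ * (ψm x)ᴴ * J) * ψp x := by
        rw [mul_eq_one_comm.1 (hleft x), Matrix.one_mul]
      _ = ψm x * (diagonal (jostNorm q₀ z)⁻¹ * ((ψm x)ᴴ * J * ψp x)) := by
        simp only [Matrix.mul_assoc]
      _ = ψm x * (diagonal (jostNorm q₀ z)⁻¹ * ((ψm 0)ᴴ * J * ψp 0)) := by
        rw [hψm.isMatrixSolution.conjTranspose_mul_eq hψp.isMatrixSolution x 0]
  · rintro H ⟨ψm', ψp', hψm', hψp', hH⟩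
    obtain rfl := hψm.unique inferInstance hq₀ hqm hz h1 h2 hψm'
    obtain rfl := hψp.unique inferInstance hq₀ hqp hz h1 h2 hψp'
    rw [hH 0, ← Matrix.mul_assoc, ← Matrix.mul_assoc, ← Matrix.mul_assoc, hleft 0, Matrix.one_mul]

lemma IsScatteringMatrix.conjTranspose_mul (hH : IsScatteringMatrix σ q₀ qm qp q t z H)
    (hq₀ : q₀ ≠ 0) (hqm : ‖qm‖ = q₀) (hqp : ‖qp‖ = q₀) (hz : z ≠ 0) (h1 : z ≠ q₀) (h2 : z ≠ -q₀) :
    Hᴴ * diagonal (jostNorm q₀ z) * H = diagonal (jostNorm q₀ z) := by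
  obtain ⟨ψm, ψp, hψm, hψp, hH⟩ := hH
  calc Hᴴ * diagonal (jostNorm q₀ z) * H
    _ = (ψm 0 * H)ᴴ * J * (ψm 0 * H) := by
      rw [← hψm.conjTranspose_mul inferInstance hq₀ hqm hz h1 h2 hψm 0, Matrix.conjTranspose_mul]
      simp only [Matrix.mul_assoc]
    _ = diagonal (jostNorm q₀ z) := by
      rw [← hH 0, hψp.conjTranspose_mul inferInstance hq₀ hqp hz h1 h2 hψp 0]

lemma ReflectionVanishes.col_zero {d : Fin 3 → ℂ} (hd : ∀ j, d j ≠ 0)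
    (hH : Hᴴ * diagonal d * H = diagonal d) (hr : ReflectionVanishes H) :
    H 1 0 = 0 ∧ H 2 0 = 0 ∧ ‖H 0 0‖ = 1 := by
  have hinv : H⁻¹ = diagonal d⁻¹ * Hᴴ * diagonal d :=
    inv_eq_left_inv (diagonal_inv_mul_conjTranspose_mul hd hH)
  have h10 : H 1 0 = 0 := (div_eq_zero_iff.1 hr.beta₂_eq_zero).resolve_right hr.h₁₁_ne_zero
  have h20 : H 2 0 = 0 := by
    have h := (div_eq_zero_iff.1 hr.beta₁_eq_zero).resolve_right hr.s₁₁_ne_zero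
    simpa [hinv, mul_diagonal, diagonal_mul, hd] using h
  have h00 : star (H 0 0) * d 0 * H 0 0 = d 0 := by
    simpa [mul_apply, Fin.sum_univ_three, diagonal, h10, h20] using congr($hH 0 0)
  have hsq : ‖H 0 0‖ ^ 2 * ‖d 0‖ = ‖d 0‖ := by
    simpa [pow_two, mul_right_comm] using congr(‖$h00‖)
  refine ⟨h10, h20, ?_⟩
  simpa [norm_ne_zero_iff.2 (hd 0), pow_eq_one_iff_of_nonneg (norm_nonneg (H 0 0))] using hsq

lemma IsScatteringMatrix.exists_isDistortedPlaneWave_of_reflectionVanishes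
    (hH : IsScatteringMatrix σ q₀ qm qp q t z H) (hr : ReflectionVanishes H)
    (hq₀ : q₀ ≠ 0) (hqm : ‖qm‖ = q₀) (hqp : ‖qp‖ = q₀) (hz : z ≠ 0) (h1 : z ≠ q₀) (h2 : z ≠ -q₀) :
    ∃ φm φp : ℝ → Matrix (Fin 3) (Fin 3) ℂ, ∃ h : ℂ,
      IsDistortedPlaneWave σ q₀ z t (fun x => q x t) atBot qm φm ∧
      IsDistortedPlaneWave σ q₀ z t (fun x => q x t) atTop qp φp ∧
      ‖h‖ = 1 ∧ ∀ x i, φp x i 0 = h * φm x i 0 := by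
  obtain ⟨h10, h20, h00⟩ := hr.col_zero (jostNorm_ne_zero hq₀ hz h1 h2)
    (hH.conjTranspose_mul hq₀ hqm hqp hz h1 h2)
  obtain ⟨ψm, ψp, hψm, hψp, hH⟩ := hH
  refine ⟨_, _, H 0 0, (isJost_iff hq₀ hz h1 h2).1 hψm, (isJost_iff hq₀ hz h1 h2).1 hψp, h00,
    fun x i => ?_⟩
  simp only [hH x]
  rw [mul_diagonal, mul_diagonal, mul_apply, Fin.sum_univ_three, h10, h20]
  ring

end Scattering

section FirstColumn

variable {σ q₀ z t : ℝ} {w : ℝ → EuclideanSpace ℂ (Fin 2)} {v : EuclideanSpace ℂ (Fin 2)}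
  {ψ : ℝ → Matrix (Fin 3) (Fin 3) ℂ}

lemma hasDerivAt_of_apply {n : ℕ} {u : ℝ → EuclideanSpace ℂ (Fin n)}
    {u' : EuclideanSpace ℂ (Fin n)} {x : ℝ} (h : ∀ i, HasDerivAt (fun y => u y i) (u' i) x) :
    HasDerivAt u u' x :=
  ((PiLp.continuousLinearEquiv 2 ℝ fun _ : Fin n => ℂ).symm :
    (Fin n → ℂ) →L[ℝ] EuclideanSpace ℂ (Fin n)).hasFDerivAt.comp_hasDerivAt x (hasDerivAt_pi.2 h)

/-- The last two entries of the first column of a matrix, the slow components of a Jost solution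
as `z → 0`. -/
def lowerColumn (A : Matrix (Fin 3) (Fin 3) ℂ) : EuclideanSpace ℂ (Fin 2) := !₂[A 1 0, A 2 0]

lemma norm_sq_add_norm_lowerColumn_sq_le (A : Matrix (Fin 3) (Fin 3) ℂ) :
    ‖A 0 0‖ ^ 2 + ‖lowerColumn A‖ ^ 2 ≤ ‖A‖ ^ 2 := by
  have h := l2_opNorm_mulVec A (EuclideanSpace.single 0 1)
  rw [PiLp.norm_single, norm_one, mul_one] at h
  refine le_trans (le_of_eq ?_) (pow_le_pow_left₀ (norm_nonneg _) h 2)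
  simp [EuclideanSpace.norm_sq_eq, lowerColumn, Fin.sum_univ_three, add_assoc]

lemma norm_lowerColumn_le (A : Matrix (Fin 3) (Fin 3) ℂ) : ‖lowerColumn A‖ ≤ ‖A‖ :=
  (sq_le_sq₀ (norm_nonneg _) (norm_nonneg _)).1 <|
    (le_add_of_nonneg_left (sq_nonneg _)).trans (norm_sq_add_norm_lowerColumn_sq_le A)

lemma norm_entry_zero_le (A : Matrix (Fin 3) (Fin 3) ℂ) : ‖A 0 0‖ ≤ ‖A‖ :=
  (sq_le_sq₀ (norm_nonneg _) (norm_nonneg _)).1 <|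
    (le_add_of_nonneg_right (sq_nonneg _)).trans (norm_sq_add_norm_lowerColumn_sq_le A)

lemma IsMatrixSolution.isVectorSolution (hψ : IsMatrixSolution q₀ z w ψ) :
    IsVectorSolution q₀ z w (fun x => ψ x 0 0) (fun x => lowerColumn (ψ x)) where
  hasDerivAt_fst x := by
    refine (hasDerivAt_matrix.1 (hψ x) 0 0).congr_deriv ?_
    simp [X_eq, mul_apply, Fin.sum_univ_three, lowerColumn, PiLp.inner_apply]
    ring
  hasDerivAt_snd x := by
    refine hasDerivAt_of_apply fun i => ?_
    fin_cases i
    · refine (hasDerivAt_matrix.1 (hψ x) 1 0).congr_deriv ?_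
      simp [X_eq, mul_apply, Fin.sum_univ_three, lowerColumn]
      ring
    · refine (hasDerivAt_matrix.1 (hψ x) 2 0).congr_deriv ?_
      simp [X_eq, mul_apply, Fin.sum_univ_three, lowerColumn]
      ring

lemma norm_smul_lowerColumn_sub_le (σ t : ℝ) (A : Matrix (Fin 3) (Fin 3) ℂ) (x : ℝ) :
    ‖exp (I * ↑(-(lam q₀ z * x))) • lowerColumn A - exp (I * phase σ q₀ z 0 t 0) • v‖ ≤
      ‖A - planeWave σ q₀ z t v x‖ := by
  have hv : exp (I * phase σ q₀ z 0 t 0) • v =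
      exp (I * ↑(-(lam q₀ z * x))) • lowerColumn (planeWave σ q₀ z t v x) := by
    have hphase : exp (I * phase σ q₀ z 0 t 0) =
        exp (I * ↑(-(lam q₀ z * x))) * exp (I * phase σ q₀ z x t 0) := by
      rw [← exp_add, ← mul_add, ← ofReal_add, phase_eq σ q₀ z x t 0]
      simp [freq]
    have hF : lowerColumn (planeWave σ q₀ z t v x) = exp (I * phase σ q₀ z x t 0) • v := by
      rw [planeWave, expIDelta_eq]
      ext i
      fin_cases i <;> simp [lowerColumn, eigenbasis, mul_comm]
    rw [hphase, hF, mul_smul]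
  have hsub : lowerColumn A - lowerColumn (planeWave σ q₀ z t v x) =
      lowerColumn (A - planeWave σ q₀ z t v x) := by
    ext i
    fin_cases i <;> rfl
  rw [hv, ← smul_sub, norm_smul, norm_exp_I_mul_ofReal, one_mul, hsub]
  exact norm_lowerColumn_le _

end FirstColumn

section SmallSpectralParameter

variable {σ q₀ t : ℝ} {w : ℝ → EuclideanSpace ℂ (Fin 2)} {v : EuclideanSpace ℂ (Fin 2)}
  {l : Filter ℝ} {S : ℝ → Set ℝ}

lemma exists_norm_eigenbasis_le (hq₀ : 0 < q₀) (v : EuclideanSpace ℂ (Fin 2)) :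
    ∃ K, ∀ z ∈ Set.Ioc 0 (q₀ / 2),
      ‖eigenbasis q₀ z v‖ ≤ K ∧ ‖diagonal (eigenNorm q₀ z)⁻¹‖ ≤ K := by
  have hcont : Continuous fun z => eigenbasis q₀ z v := by
    refine continuous_matrix fun i j => ?_
    fin_cases i <;> fin_cases j <;> simp only [eigenbasis] <;> fun_prop
  have hcont' : ContinuousOn (fun z => diagonal (eigenNorm q₀ z)⁻¹) (Set.Icc 0 (q₀ / 2)) := by
    have hd : Continuous (eigenNorm q₀) := by
      refine continuous_pi fun j => ?_
      fin_cases j <;> simp only [eigenNorm] <;> fun_prop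
    refine continuous_id.matrix_diagonal.comp_continuousOn (continuousOn_pi.2 fun j =>
      ((continuous_pi_iff.1 hd j).continuousOn).inv₀ fun z hz => ?_)
    exact eigenNorm_ne_zero hq₀.ne' (by linarith [hz.2]) (by linarith [hz.1]) j
  obtain ⟨K, hK⟩ := isCompact_Icc.exists_bound_of_continuousOn (hcont.continuousOn.prodMk hcont')
  exact ⟨K, fun z hz => norm_prod_le_iff.1 (hK z (Set.Ioc_subset_Icc_self hz))⟩

lemma exists_norm_sub_planeWave_le (hl : IsEnd l S) (hq₀ : 0 < q₀) (hv : ‖v‖ = q₀)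
    (hw : Continuous w) (hint : IntegrableAtFilter (fun y => w y - v) l) :
    ∃ K, ∀ z ∈ Set.Ioc 0 (q₀ / 2), ∀ ψ, IsDistortedPlaneWave σ q₀ z t w l v ψ →
      ∀ x, ‖planeWave σ q₀ z t v x‖ ≤ K ∧ ‖ψ x - planeWave σ q₀ z t v x‖ ≤
        K * (Real.exp (K ^ 3 * ∫ y in S x, ‖Q (w y - v)‖) - 1) := by
  obtain ⟨K, hK⟩ := exists_norm_eigenbasis_le hq₀ v
  refine ⟨K, fun z hz ψ hψ x => ⟨(norm_planeWave_le x).trans (hK z hz).1, ?_⟩⟩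
  have h1 : z ≠ q₀ := by linarith [hz.2]
  have h2 : z ≠ -q₀ := by linarith [hz.1]
  obtain ⟨φ, hφ, hle⟩ := exists_isDistortedPlaneWave (σ := σ) (t := t) hl hq₀.ne' hv hz.1.ne' h1 h2
    hw hint (hK z hz).1 (hK z hz).2
  rw [hψ.unique hl.neBot hq₀.ne' hv h1 h2 hφ]
  exact hle x

lemma eventually_norm_sub_planeWave_le (hl : IsEnd l S) (hq₀ : 0 < q₀) (hv : ‖v‖ = q₀)
    (hw : Continuous w) (hint : IntegrableAtFilter (fun y => w y - v) l) {ε : ℝ} (hε : 0 < ε) :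
    ∀ᶠ x in l, ∀ z ∈ Set.Ioc 0 (q₀ / 2), ∀ ψ, IsDistortedPlaneWave σ q₀ z t w l v ψ →
      ‖ψ x - planeWave σ q₀ z t v x‖ ≤ ε := by
  obtain ⟨K, hK⟩ := exists_norm_sub_planeWave_le (σ := σ) (t := t) hl hq₀ hv hw hint
  have hlim :
      Tendsto (fun x => K * (Real.exp (K ^ 3 * ∫ y in S x, ‖Q (w y - v)‖) - 1)) l (𝓝 0) := by
    simpa using (((hl.tendsto_integral fun y => ‖Q (w y - v)‖).const_mul
      (K ^ 3)).rexp.sub_const 1).const_mul K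
  filter_upwards [hlim.eventually_le_const hε] with x hx z hz ψ hψ
  exact (hK z hz ψ hψ x).2.trans hx

lemma exists_forall_ge_norm_le (hq₀ : 0 < q₀) (hv : ‖v‖ = q₀) (hw : Continuous w)
    (hint : IntegrableAtFilter (fun y => w y - v) atTop) (R : ℝ) :
    ∃ M, ∀ z ∈ Set.Ioc 0 (q₀ / 2), ∀ ψ, IsDistortedPlaneWave σ q₀ z t w atTop v ψ →
      ∀ x ≥ R, ‖ψ x‖ ≤ M := by
  obtain ⟨K, hK⟩ := exists_norm_sub_planeWave_le (σ := σ) (t := t) .top hq₀ hv hw hint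
  refine ⟨K * (Real.exp (K ^ 3 * ∫ y in Set.Ioi R, ‖Q (w y - v)‖) - 1) + K,
    fun z hz ψ hψ x hx => ?_⟩
  obtain ⟨hF, hψF⟩ := hK z hz ψ hψ x
  have hK0 : 0 ≤ K := (norm_nonneg _).trans hF
  have htail : ∫ y in Set.Ioi x, ‖Q (w y - v)‖ ≤ ∫ y in Set.Ioi R, ‖Q (w y - v)‖ :=
    setIntegral_mono_set
      (integrableOn_Q (IsEnd.top.integrableOn (hw.sub continuous_const) hint R)).norm
      (ae_of_all _ fun _ => norm_nonneg _) (Set.Ioi_subset_Ioi hx).eventuallyLE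
  calc ‖ψ x‖
    _ ≤ ‖ψ x - planeWave σ q₀ z t v x‖ + ‖planeWave σ q₀ z t v x‖ := norm_le_norm_sub_add _ _
    _ ≤ _ := add_le_add (hψF.trans (by gcongr)) hF

lemma eventually_norm_sub_smul_le_of_firstColumns {qm qp : EuclideanSpace ℂ (Fin 2)} (hq₀ : 0 < q₀)
    (hqm : ‖qm‖ = q₀) (hqp : ‖qp‖ = q₀) (hw : ContDiff ℝ 1 w)
    (hm : IntegrableAtFilter (fun x => w x - qm) atBot)
    (hp : IntegrableAtFilter (fun x => w x - qp) atTop) {ε : ℝ} (hε : 0 < ε) :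
    ∀ᶠ z in 𝓝[>] 0, ∀ φm φp h, IsDistortedPlaneWave σ q₀ z t w atBot qm φm →
      IsDistortedPlaneWave σ q₀ z t w atTop qp φp → ‖h‖ = 1 →
      (∀ x i, φp x i 0 = h * φm x i 0) → ‖qp - h • qm‖ ≤ ε := by
  have hε3 : 0 < ε / 3 := by positivity
  obtain ⟨R₁, hR₁⟩ := (eventually_norm_sub_planeWave_le (σ := σ) (t := t) .bot hq₀ hqm
    hw.continuous hm hε3).exists
  obtain ⟨R₂, hR₂, hR⟩ := ((eventually_norm_sub_planeWave_le (σ := σ) (t := t) .top hq₀ hqp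
    hw.continuous hp hε3).and (eventually_ge_atTop R₁)).exists
  obtain ⟨M, hM⟩ := exists_forall_ge_norm_le (σ := σ) (t := t) hq₀ hqp hw.continuous hp R₁
  obtain ⟨C, hC⟩ := exists_norm_slow_sub_le hq₀.ne' hw hR M
  have hCz : ∀ᶠ z in 𝓝[>] (0 : ℝ), C * z ≤ ε / 3 := by
    have hlim : Tendsto (C * ·) (𝓝[>] 0) (𝓝 0) :=
      ((continuous_const_mul C).tendsto' 0 0 (mul_zero C)).mono_left nhdsWithin_le_nhds
    exact hlim.eventually_le_const hε3
  filter_upwards [hCz, Ioc_mem_nhdsGT (half_pos hq₀)] with z hCz hz φm φp h hφm hφp hh hcol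
  set e : ℝ → ℂ := fun x => exp (I * ↑(-(lam q₀ z * x)))
  set c := exp (I * phase σ q₀ z 0 t 0)
  have hlower : lowerColumn (φp R₁) = h • lowerColumn (φm R₁) := by
    ext i
    fin_cases i <;> simp [lowerColumn, hcol]
  have hslow : ‖e R₂ • lowerColumn (φp R₂) - e R₁ • lowerColumn (φp R₁)‖ ≤ ε / 3 :=
    (hC z hz.1 _ _ hφp.isMatrixSolution.isVectorSolution
      (fun x hx => (norm_entry_zero_le _).trans (hM z hz φp hφp x hx.1))
      fun x hx => (norm_lowerColumn_le _).trans (hM z hz φp hφp x hx.1)).trans hCz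
  have hright : ‖e R₂ • lowerColumn (φp R₂) - c • qp‖ ≤ ε / 3 :=
    (norm_smul_lowerColumn_sub_le σ t _ _).trans (hR₂ z hz φp hφp)
  have hleft : ‖e R₁ • lowerColumn (φp R₁) - c • h • qm‖ ≤ ε / 3 := by
    rw [hlower, smul_comm, smul_comm c, ← smul_sub, norm_smul, hh, one_mul]
    exact (norm_smul_lowerColumn_sub_le σ t _ _).trans (hR₁ z hz φm hφm)
  calc ‖qp - h • qm‖
    _ = ‖c • qp - c • h • qm‖ := by
      rw [← smul_sub, norm_smul, norm_exp_I_mul_ofReal, one_mul]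
    _ ≤ ‖e R₂ • lowerColumn (φp R₂) - c • qp‖ + ‖e R₂ • lowerColumn (φp R₂) -
          e R₁ • lowerColumn (φp R₁)‖ + ‖e R₁ • lowerColumn (φp R₁) - c • h • qm‖ := by
      rw [← dist_eq_norm, ← dist_eq_norm', ← dist_eq_norm, ← dist_eq_norm]
      exact dist_triangle4 _ _ _ _
    _ ≤ ε := by linarith

lemma eventually_not_reflectionVanishes {q : ℝ → ℝ → EuclideanSpace ℂ (Fin 2)}
    {qm qp : EuclideanSpace ℂ (Fin 2)} (hq₀ : 0 < q₀) (hqm : ‖qm‖ = q₀) (hqp : ‖qp‖ = q₀)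
    (hnonpar : ‖inner ℂ qp qm‖ / q₀ ^ 2 < 1) (hq : ContDiff ℝ 1 fun x => q x t)
    (hm : IntegrableAtFilter (fun x => q x t - qm) atBot)
    (hp : IntegrableAtFilter (fun x => q x t - qp) atTop) :
    ∀ᶠ z in 𝓝[>] 0, ∀ H, IsScatteringMatrix σ q₀ qm qp q t z H → ¬ ReflectionVanishes H := by
  have hgap : 0 < q₀ ^ 2 - ‖inner ℂ qp qm‖ := sub_pos.2 ((div_lt_one (by positivity)).1 hnonpar)
  have hε : 0 < (q₀ ^ 2 - ‖inner ℂ qp qm‖) / (2 * q₀) := by positivity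
  filter_upwards [eventually_norm_sub_smul_le_of_firstColumns (σ := σ) hq₀ hqm hqp hq hm hp hε,
    Ioo_mem_nhdsGT hq₀] with z hsmall hz H hH hr
  obtain ⟨φm, φp, h, hφm, hφp, hh, hcol⟩ :=
    hH.exists_isDistortedPlaneWave_of_reflectionVanishes hr hq₀.ne' hqm hqp hz.1.ne' hz.2.ne
      (by linarith [hz.1])
  have hle := sq_norm_sub_norm_inner_le qp qm hh
  have hmul := mul_le_mul_of_nonneg_left (hsmall φm φp h hφm hφp hh hcol) hq₀.le
  have hhalf : q₀ * ((q₀ ^ 2 - ‖inner ℂ qp qm‖) / (2 * q₀)) =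
      (q₀ ^ 2 - ‖inner ℂ qp qm‖) / 2 := by
    field_simp
  rw [hqp] at hle
  linarith

end SmallSpectralParameter

end CoupledHirota

end

open CoupledHirota in
theorem theorem3_general (σ q₀ : ℝ) (hq₀ : 0 < q₀)
    (qm qp : EuclideanSpace ℂ (Fin 2)) (hqm : ‖qm‖ = q₀) (hqp : ‖qp‖ = q₀)
    (hnonpar : ‖inner ℂ qp qm‖ / q₀ ^ 2 < 1)
    (q : ℝ → ℝ → EuclideanSpace ℂ (Fin 2)) (t : ℝ) (hq : ContDiff ℝ 1 fun x => q x t)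
    (hintm : IntegrableAtFilter (fun x => q x t - qm) atBot)
    (hintp : IntegrableAtFilter (fun x => q x t - qp) atTop) :
    (∀ z : ℝ, z ≠ 0 → z ≠ q₀ → z ≠ -q₀ → ∃! H, IsScatteringMatrix σ q₀ qm qp q t z H) ∧
      ∀ᶠ z in 𝓝[>] (0 : ℝ), ∀ H, IsScatteringMatrix σ q₀ qm qp q t z H →
        ¬ ReflectionVanishes H :=
  ⟨fun _ hz h1 h2 => existsUnique_isScatteringMatrix hq₀.ne' hqm hqp hz h1 h2 hq.continuous
      hintm hintp,
    eventually_not_reflectionVanishes hq₀ hqm hqp hnonpar hq hintm hintp⟩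

theorem theorem3 (σ q₀ : ℝ) (hq₀ : 0 < q₀)
    (qm qp : EuclideanSpace ℂ (Fin 2)) (hqm : ‖qm‖ = q₀) (hqp : ‖qp‖ = q₀)
    (hnonpar : ‖inner ℂ qp qm‖ / q₀ ^ 2 < 1)
    (q : ℝ → ℝ → EuclideanSpace ℂ (Fin 2))
    (hsol : CoupledHirota.IsSolution σ q₀ q)
    (hbot : ∀ t, Tendsto (fun x => q x t) atBot (𝓝 qm))
    (htop : ∀ t, Tendsto (fun x => q x t) atTop (𝓝 qp))
    (hintm : ∀ t, IntegrableOn (fun x => q x t - qm) (Set.Iio 0))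
    (hintp : ∀ t, IntegrableOn (fun x => q x t - qp) (Set.Ioi 0))
    (t : ℝ) :
    (∀ z : ℝ, z ≠ 0 → z ≠ q₀ → z ≠ -q₀ →
        ∃! H, CoupledHirota.IsScatteringMatrix σ q₀ qm qp q t z H) ∧
    ∀ H : ℝ → Matrix (Fin 3) (Fin 3) ℂ,
      (∀ z : ℝ, z ≠ 0 → z ≠ q₀ → z ≠ -q₀ →
        CoupledHirota.IsScatteringMatrix σ q₀ qm qp q t z (H z)) →
      ¬ ∀ z : ℝ, z ≠ 0 → z ≠ q₀ → z ≠ -q₀ → CoupledHirota.ReflectionVanishes (H z) := by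
  obtain ⟨hex, hnot⟩ := theorem3_general σ q₀ hq₀ qm qp hqm hqp hnonpar q t
    ((hsol.contDiff_x t).of_le (by norm_num)) ⟨_, Iio_mem_atBot 0, hintm t⟩
    ⟨_, Ioi_mem_atTop 0, hintp t⟩
  refine ⟨hex, fun H hH hr => ?_⟩
  obtain ⟨z, hz, hz'⟩ := (hnot.and (Ioo_mem_nhdsGT hq₀)).exists
  have h2 : z ≠ -q₀ := by linarith [hz'.1]
  exact hz (H z) (hH z hz'.1.ne' hz'.2.ne h2) (hr z hz'.1.ne' hz'.2.ne h2)
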